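/- A $C^\infty$-ring is a set $\mathfrak C$ with an operation $\Phi_f:\mathfrak C^n\to\mathfrak C$ for every $n\ge 0$ and every smooth $f:\mathbb R^n\to\mathbb R$, such that $\Phi_{g\circ(f_1,\dots,f_m)}(c)=\Phi_g(\Phi_{f_1}(c),\dots,\Phi_{f_m}(c))$ for all smooth $f_1,\dots,f_m:\mathbb R^n\to\mathbb R$, $g:\mathbb R^m\to\mathbb R$ and $c\in\mathfrak C^n$, and $\Phi_{x_j}(c_1,\dots,c_n)=c_j$ for each coordinate function $x_j$. Morphisms are maps commuting with all $\Phi_f$; write $\mathbf{C^\infty Rings}$ for the resulting category. The set $C^\infty(\mathbb R^n)$ of smooth functions $\mathbb R^n\to\mathbb R$ is a $C^\infty$-ring under $\Phi_f(c_1,\dots,c_k)=f\circ(c_1,\dots,c_k)$, and so is its quotient $C^\infty(\mathbb R^n)/I$ by any ideal $I$ (for the pointwise ring structure). For closed $X\subseteq\mathbb R^n$ let $\mathfrak m_X^\infty\subseteq C^\infty(\mathbb R^n)$ be the ideal of functions which vanish on $X$ together with all their derivatives. An ideal $I$ of $C^\infty(\mathbb R^n)$ is good if $I=(f_1,\dots,f_k,\mathfrak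 m_X^\infty)$ for some $k\ge 0$, $f_1,\dots,f_k\in C^\infty(\mathbb R^n)$ and closed $X\subseteq\mathbb R^n$. A $C^\infty$-ring $\mathfrak C$ is - finitely generated if there are $n\ge 0$ and $c_1,\dots,c_n\in\mathfrak C$ such that every element of $\mathfrak C$ is $\Phi_f(c_1,\dots,c_n)$ for some smooth $f:\mathbb R^n\to\mathbb R$; - finitely presented if $\mathfrak C\cong C^\infty(\mathbb R^n)/I$ for some $n\ge 0$ and some finitely generated ideal $I$; - good if $\mathfrak C\cong C^\infty(\mathbb R^n)/I$ for some $n\ge 0$ and some good ideal $I$. **Proposition.** Each of the full subcategories of finitely generated, of finitely presented and of good $C^\infty$-rings is closed under pushouts and under all finite colimits in $\mathbf{C^\infty Rings}$. That is, let $\mathbf P$ be any one of these three subcategories. Any two morphisms $\mathfrak C\to\mathfrak D$, $\mathfrak C\to\mathfrak E$ in $\mathbf P$ have a pushout in $\mathbf{C^\infty Rings}$, and every such pushout lies in $\mathbf P$. Any diagram in $\mathbf P$ indexed by a finite category (possibly empty) has a colimit in $\mathbf{C^\infty Rings}$, and every such colimit lies in $\mathbf P$. -/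

import Mathlib

open CategoryTheory CategoryTheory.Limits
open scoped ContDiff

universe u v w

namespace SmoothRings

/-! ### Smooth functions on Euclidean space -/

/-- The `ℝ`-algebra (under pointwise operations) of smooth functions `ℝⁿ → ℝ`. -/
def smoothSubalgebra (n : ℕ) : Subalgebra ℝ ((Fin n → ℝ) → ℝ) where
  carrier := {f | ContDiff ℝ ∞ f}
  mul_mem' := fun {f g} (hf : ContDiff ℝ ∞ f) (hg : ContDiff ℝ ∞ g) => by
    show ContDiff ℝ ∞ (f * g)
    exact hf.mul hg
  add_mem' := fun {f g} (hf : ContDiff ℝ ∞ f) (hg : ContDiff ℝ ∞ g) => by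
    show ContDiff ℝ ∞ (f + g)
    exact hf.add hg
  algebraMap_mem' := fun r => by
    show ContDiff ℝ ∞ (fun _ : Fin n → ℝ => r)
    exact contDiff_const

/-- `C^∞(ℝⁿ)`. -/
abbrev CInf (n : ℕ) : Type := smoothSubalgebra n

namespace CInf

theorem smooth {n : ℕ} (f : CInf n) : ContDiff ℝ ∞ f.1 := f.2

/-- The element of `C^∞(ℝⁿ)` given by a smooth function. -/
def mk {n : ℕ} (f : (Fin n → ℝ) → ℝ) (hf : ContDiff ℝ ∞ f) : CInf n := ⟨f, hf⟩

/-- The coordinate function `(x₁, …, xₙ) ↦ xⱼ`. -/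
def coord {n : ℕ} (j : Fin n) : CInf n :=
  mk (fun x => x j) (contDiff_apply ℝ ℝ j)

/-- The composite `x ↦ g (f₁ x, …, fₘ x)`. -/
def comp {m n : ℕ} (g : CInf m) (f : Fin m → CInf n) : CInf n :=
  mk (fun x => g.1 (fun i => (f i).1 x)) (g.smooth.comp (contDiff_pi.2 fun i => (f i).smooth))

end CInf

/-! ### `C^∞`-rings and their category -/

/-- A `C^∞`-ring: a set with an `n`-ary operation `Φ_f` for every `n` and every smooth
`f : ℝⁿ → ℝ`, compatible with composition and with the coordinate projections. -/
class CInfRing (C : Type u) where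
  op : ∀ {n : ℕ}, CInf n → (Fin n → C) → C
  op_comp : ∀ {m n : ℕ} (g : CInf m) (f : Fin m → CInf n) (c : Fin n → C),
    op (CInf.comp g f) c = op g (fun i => op (f i) c)
  op_coord : ∀ {n : ℕ} (j : Fin n) (c : Fin n → C), op (CInf.coord j) c = c j

/-- Morphisms of `C^∞`-rings: maps commuting with all operations. -/
@[ext]
structure CInfHom (C : Type u) (D : Type v) [CInfRing C] [CInfRing D] where
  toFun : C → D
  map_op : ∀ {n : ℕ} (f : CInf n) (c : Fin n → C),
    toFun (CInfRing.op f c) = CInfRing.op f (fun i => toFun (c i))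

/-- Isomorphisms of `C^∞`-rings, possibly living in different universes: bijective morphisms. -/
structure CInfEquiv (C : Type u) (D : Type v) [CInfRing C] [CInfRing D] extends C ≃ D where
  map_op : ∀ {n : ℕ} (f : CInf n) (c : Fin n → C),
    toFun (CInfRing.op f c) = CInfRing.op f (fun i => toFun (c i))

/-- Bundled `C^∞`-rings. -/
structure CInfRingCat : Type (u + 1) where
  carrier : Type u
  [str : CInfRing carrier]

attribute [instance] CInfRingCat.str

/-- The category of `C^∞`-rings. -/
instance : Category CInfRingCat.{u} where
  Hom C D := CInfHom C.carrier D.carrier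
  id C := { toFun := fun c => c, map_op := fun _ _ => rfl }
  comp φ ψ :=
    { toFun := fun c => ψ.toFun (φ.toFun c)
      map_op := fun f c => by rw [φ.map_op, ψ.map_op] }

/-- `C^∞(ℝⁿ)` as a `C^∞`-ring: `Φ_f (c₁, …, cₖ) = f ∘ (c₁, …, cₖ)`. -/
instance (n : ℕ) : CInfRing (CInf n) where
  op f c := CInf.comp f c
  op_comp _ _ _ := rfl
  op_coord _ _ := rfl

/-! ### Hadamard's lemma and the quotients `C^∞(ℝⁿ)/I` -/

theorem hasFDerivAt_integral_param {E G : Type} [NormedAddCommGroup E] [NormedSpace ℝ E]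
    [FiniteDimensional ℝ E] [NormedAddCommGroup G] [NormedSpace ℝ G]
    (F : E × ℝ → G) (hF : ContDiff ℝ ∞ F) (x₀ : E) :
    HasFDerivAt (fun x => ∫ t in (0 : ℝ)..1, F (x, t))
      (∫ t in (0 : ℝ)..1, (fderiv ℝ F (x₀, t)).comp (ContinuousLinearMap.inl ℝ E ℝ)) x₀ := by
  have hF' : Continuous fun p : E × ℝ =>
      (fderiv ℝ F p).comp (ContinuousLinearMap.inl ℝ E ℝ) :=
    (hF.continuous_fderiv (by simp)).clm_comp continuous_const
  have hK : IsCompact (Metric.closedBall x₀ 1 ×ˢ Set.uIcc (0 : ℝ) 1) :=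
    (isCompact_closedBall x₀ 1).prod isCompact_uIcc
  obtain ⟨B, hB⟩ := hK.exists_bound_of_continuousOn hF'.continuousOn
  refine intervalIntegral.hasFDerivAt_integral_of_dominated_of_fderiv_le (𝕜 := ℝ)
    (F := fun x t => F (x, t))
    (F' := fun x t => (fderiv ℝ F (x, t)).comp (ContinuousLinearMap.inl ℝ E ℝ))
    (bound := fun _ => B) (Metric.closedBall_mem_nhds x₀ one_pos) ?_ ?_ ?_ ?_ ?_ ?_
  · exact Filter.Eventually.of_forall fun x =>
      (hF.continuous.comp (by fun_prop : Continuous fun t : ℝ => (x, t))).aestronglyMeasurable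
  · exact (hF.continuous.comp
      (by fun_prop : Continuous fun t : ℝ => (x₀, t))).intervalIntegrable _ _
  · exact (hF'.comp (by fun_prop : Continuous fun t : ℝ => (x₀, t))).aestronglyMeasurable
  · exact Filter.Eventually.of_forall fun t ht x hx =>
      hB (x, t) ⟨hx, Set.uIoc_subset_uIcc ht⟩
  · exact intervalIntegrable_const
  · refine Filter.Eventually.of_forall fun t _ x _ => ?_
    have h1 : HasFDerivAt F (fderiv ℝ F (x, t)) (x, t) :=
      ((hF.differentiable (by simp)) (x, t)).hasFDerivAt
    exact h1.comp x (hasFDerivAt_prodMk_left x t)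

theorem contDiff_integral_param_nat {E : Type} [NormedAddCommGroup E] [NormedSpace ℝ E]
    [FiniteDimensional ℝ E] (k : ℕ) :
    ∀ {G : Type} [NormedAddCommGroup G] [NormedSpace ℝ G] (F : E × ℝ → G),
      ContDiff ℝ ∞ F → ContDiff ℝ k (fun x => ∫ t in (0 : ℝ)..1, F (x, t)) := by
  induction k with
  | zero =>
    intro G _ _ F hF
    exact contDiff_zero.2 (continuous_iff_continuousAt.2 fun x =>
      (hasFDerivAt_integral_param F hF x).continuousAt)
  | succ k ih =>
    intro G _ _ F hF
    rw [Nat.cast_succ]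
    refine contDiff_succ_iff_fderiv.2 ⟨fun x =>
      (hasFDerivAt_integral_param F hF x).differentiableAt, fun h => absurd h (WithTop.coe_ne_top (a := (k : ℕ∞))), ?_⟩
    have : fderiv ℝ (fun x => ∫ t in (0 : ℝ)..1, F (x, t)) = fun x =>
        ∫ t in (0 : ℝ)..1, (fderiv ℝ F (x, t)).comp (ContinuousLinearMap.inl ℝ E ℝ) :=
      funext fun x => (hasFDerivAt_integral_param F hF x).fderiv
    rw [this]
    exact ih (fun p => (fderiv ℝ F p).comp (ContinuousLinearMap.inl ℝ E ℝ))
      ((hF.fderiv_right (m := ∞) (by simp)).clm_comp contDiff_const)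

/-- Hadamard's lemma. -/
theorem hadamard {n : ℕ} (f : CInf n) :
    ∃ g : Fin n → (Fin n → ℝ) × (Fin n → ℝ) → ℝ, (∀ i, ContDiff ℝ ∞ (g i)) ∧
      ∀ x y, f.1 y - f.1 x = ∑ i, (y i - x i) * g i (x, y) := by
  have hf : ContDiff ℝ ∞ f.1 := f.2
  have hf' : ContDiff ℝ ∞ (fderiv ℝ f.1) := hf.fderiv_right (m := ∞) (by simp)
  let F : Fin n → ((Fin n → ℝ) × (Fin n → ℝ)) × ℝ → ℝ := fun i p =>
    fderiv ℝ f.1 (p.1.1 + p.2 • (p.1.2 - p.1.1)) (Pi.single i 1)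
  have hF : ∀ i, ContDiff ℝ ∞ (F i) := fun i =>
    (hf'.comp (by fun_prop : ContDiff ℝ ∞ fun p : ((Fin n → ℝ) × (Fin n → ℝ)) × ℝ =>
      p.1.1 + p.2 • (p.1.2 - p.1.1))).clm_apply contDiff_const
  refine ⟨fun i q => ∫ t in (0 : ℝ)..1, F i (q, t), fun i =>
    contDiff_infty.2 fun k => contDiff_integral_param_nat k (F i) (hF i), fun x y => ?_⟩
  have hcont : ∀ i, Continuous fun t : ℝ => F i ((x, y), t) := fun i =>
    (hF i).continuous.comp (by fun_prop)
  have hder : ∀ t : ℝ, HasDerivAt (fun t : ℝ => f.1 (x + t • (y - x)))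
      (∑ i, (y i - x i) * F i ((x, y), t)) t := by
    intro t
    have h1 : HasFDerivAt f.1 (fderiv ℝ f.1 (x + t • (y - x))) (x + t • (y - x)) :=
      (hf.differentiable (by simp) _).hasFDerivAt
    have h2 : HasDerivAt (fun t : ℝ => x + t • (y - x)) (y - x) t := by
      simpa using ((hasDerivAt_id t).smul_const (y - x)).const_add x
    have h3 := h1.comp_hasDerivAt t h2
    refine h3.congr_deriv ?_
    have hsum : fderiv ℝ f.1 (x + t • (y - x)) (y - x) =
        ∑ i, fderiv ℝ f.1 (x + t • (y - x)) (Pi.single i ((y - x) i)) := by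
      rw [← map_sum, Finset.univ_sum_single]
    rw [hsum]
    refine Finset.sum_congr rfl fun i _ => ?_
    have : (Pi.single i ((y - x) i) : Fin n → ℝ) = (y i - x i) • Pi.single i (1 : ℝ) := by
      rw [← Pi.single_smul]; simp
    rw [this, map_smul]
    rfl
  have hint := intervalIntegral.integral_eq_sub_of_hasDerivAt (a := 0) (b := 1)
    (fun t _ => hder t)
    ((continuous_finsetSum _ fun i _ =>
      continuous_const.mul (hcont i)).intervalIntegrable _ _)
  rw [intervalIntegral.integral_finsetSum (f := fun i t => (y i - x i) * F i ((x, y), t))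
    fun i _ => (continuous_const.mul (hcont i)).intervalIntegrable _ _] at hint
  simp only [intervalIntegral.integral_const_mul, one_smul, zero_smul, add_zero,
    add_sub_cancel] at hint
  exact hint.symm

/-- Smooth operations on `C^∞(ℝⁿ)` respect congruence modulo an ideal. -/
theorem comp_sub_comp_mem {n k : ℕ} (I : Ideal (CInf n)) (f : CInf k) (a b : Fin k → CInf n)
    (h : ∀ i, b i - a i ∈ I) : CInf.comp f b - CInf.comp f a ∈ I := by
  obtain ⟨g, hg, hfg⟩ := hadamard f
  let G : Fin k → CInf n := fun i =>
    CInf.mk (fun x => g i (fun j => (a j).1 x, fun j => (b j).1 x)) ((hg i).comp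
      ((contDiff_pi.2 fun j => (a j).smooth).prodMk (contDiff_pi.2 fun j => (b j).smooth)))
  have : CInf.comp f b - CInf.comp f a = ∑ i, (b i - a i) * G i := by
    apply Subtype.ext
    funext x
    have := hfg (fun j => (a j).1 x) (fun j => (b j).1 x)
    simpa [CInf.comp, CInf.mk, G] using this
  rw [this]
  exact I.sum_mem fun i _ => I.mul_mem_right _ (h i)

/-- The operations on `C^∞(ℝⁿ)/I`, defined through representatives. -/
noncomputable def quotOp {n : ℕ} (I : Ideal (CInf n)) {k : ℕ} (f : CInf k)
    (c : Fin k → CInf n ⧸ I) : CInf n ⧸ I :=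
  Ideal.Quotient.mk I (CInf.comp f fun i => (c i).out)

/-- `Φ_f (c₁ + I, …, cₖ + I) = Φ_f (c₁, …, cₖ) + I`, whatever the representatives. -/
theorem quotOp_mk {n : ℕ} (I : Ideal (CInf n)) {k : ℕ} (f : CInf k) (c : Fin k → CInf n) :
    quotOp I f (fun i => Ideal.Quotient.mk I (c i)) = Ideal.Quotient.mk I (CInf.comp f c) := by
  refine Ideal.Quotient.eq.2 (comp_sub_comp_mem I f _ _ fun i => Ideal.Quotient.eq.1 ?_)
  exact Quotient.out_eq _

/-- The quotient `C^∞`-ring `C^∞(ℝⁿ)/I`. -/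
noncomputable instance {n : ℕ} (I : Ideal (CInf n)) : CInfRing (CInf n ⧸ I) where
  op f c := quotOp I f c
  op_comp g f c := by
    have h : ∀ i, quotOp I (f i) c = Ideal.Quotient.mk I (CInf.comp (f i) fun j => (c j).out) :=
      fun _ => rfl
    simp only [h]
    rw [quotOp_mk]
    rfl
  op_coord j c := Quotient.out_eq (c j)

/-! ### Finitely generated, finitely presented and good `C^∞`-rings -/

/-- The ideal `𝔪_X^∞` of smooth functions all of whose derivatives (including the function
itself) vanish on `X`. -/
def flatIdeal {n : ℕ} (X : Set (Fin n → ℝ)) : Ideal (CInf n) where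
  carrier := {g | ∀ x ∈ X, ∀ k : ℕ, iteratedFDeriv ℝ k g.1 x = 0}
  zero_mem' := fun x _ k => by
    show iteratedFDeriv ℝ k (fun _ => (0 : ℝ)) x = 0
    simp
  add_mem' := fun {a b} ha hb x hx k => by
    have h := iteratedFDeriv_add_apply (i := k) (x := x)
      (a.smooth.of_le (by exact_mod_cast le_top)).contDiffAt
      (b.smooth.of_le (by exact_mod_cast le_top)).contDiffAt
    show iteratedFDeriv ℝ k (a.1 + b.1) x = 0
    rw [h, ha x hx, hb x hx, add_zero]
  smul_mem' := fun c a ha x hx k => by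
    have h := norm_iteratedFDeriv_mul_le (n := k) c.smooth
      a.smooth x (by exact_mod_cast le_top)
    have h0 : ‖iteratedFDeriv ℝ k (fun y => c.1 y * a.1 y) x‖ ≤ 0 := by
      refine h.trans (le_of_eq (Finset.sum_eq_zero fun i _ => ?_))
      rw [ha x hx, norm_zero, mul_zero]
    exact norm_le_zero_iff.1 h0

/-- An ideal of `C^∞(ℝⁿ)` is good if it is of the form `(f₁, …, fₖ, 𝔪_X^∞)`, `X` closed. -/
def IsGoodIdeal {n : ℕ} (I : Ideal (CInf n)) : Prop :=
  ∃ (k : ℕ) (f : Fin k → CInf n) (X : Set (Fin n → ℝ)), IsClosed X ∧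
    I = Ideal.span (Set.range f ∪ (flatIdeal X : Set (CInf n)))

/-- Finitely generated `C^∞`-rings: every element is `Φ_f (c₁, …, cₙ)` for some smooth `f`,
with `c₁, …, cₙ` fixed. -/
def IsFG : ObjectProperty CInfRingCat.{u} := fun C =>
  ∃ (n : ℕ) (c : Fin n → C.carrier), ∀ d : C.carrier, ∃ f : CInf n, d = CInfRing.op f c

/-- Finitely presented `C^∞`-rings: those isomorphic to some `C^∞(ℝⁿ)/I` with `I` a finitely
generated ideal. -/
def IsFP : ObjectProperty CInfRingCat.{u} := fun C =>
  ∃ (n : ℕ) (I : Ideal (CInf n)), I.FG ∧ Nonempty (CInfEquiv C.carrier (CInf n ⧸ I))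

/-- Good `C^∞`-rings: those isomorphic to some `C^∞(ℝⁿ)/I` with `I` a good ideal. -/
def IsGood : ObjectProperty CInfRingCat.{u} := fun C =>
  ∃ (n : ℕ) (I : Ideal (CInf n)), IsGoodIdeal I ∧ Nonempty (CInfEquiv C.carrier (CInf n ⧸ I))

/-! ### Closure under pushouts and finite colimits -/

/-- The full subcategory on `P` is closed under pushouts in the category of `C^∞`-rings: any two
morphisms `α : C ⟶ D`, `β : C ⟶ E` between objects of `P` have a pushout in the category of
`C^∞`-rings, and every such pushout is an object of `P`. -/
def ClosedUnderPushouts (P : ObjectProperty CInfRingCat.{u}) : Prop :=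
  ∀ ⦃C D E : CInfRingCat.{u}⦄ (α : C ⟶ D) (β : C ⟶ E), P C → P D → P E →
    HasPushout α β ∧
      ∀ ⦃F : CInfRingCat.{u}⦄ (γ : D ⟶ F) (δ : E ⟶ F), IsPushout α β γ δ → P F

/-- The full subcategory on `P` is closed under finite colimits in the category of `C^∞`-rings:
any finite diagram of objects of `P` has a colimit in the category of `C^∞`-rings, and every such
colimit is an object of `P`. -/
def ClosedUnderFiniteColimits (P : ObjectProperty CInfRingCat.{u}) : Prop :=
  ∀ (J : Type w) [SmallCategory J] [FinCategory J] (K : J ⥤ CInfRingCat.{u}),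
    (∀ j, P (K.obj j)) →
      HasColimit K ∧ ∀ c : Cocone K, Nonempty (IsColimit c) → P c.pt

end SmoothRings

namespace SmoothRings

/-! ### Presentations of `C^∞`-rings by generators and relations -/

/-! Each of the three properties says that a ring has finitely many generators whose ideal of
relations satisfies some condition `Q` (none, finitely generated, good). A finite colimit has an
evident presentation: take the generators of all objects together, keep the relations of each
object, and for every arrow and every generator of its source identify that generator with an
expression for its image. The last kind of relation is finite in number, so closure reduces to
`StableUnderGluing Q`; pushouts are colimits over the walking span.

Only good ideals need analysis: for closed `X j`, the functions flat on `∏ X j` must form the ideal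
generated by the pullbacks of the functions flat on the `X j` (`flatIdeal_prodSet`). Given `f` flat
on `∏ X j`, choose `ε i > 0` decaying faster than every `2^(-ik)`, yet so slowly that every
derivative of `f` near the product is locally below every power of `ε` (`exists_slow_sequence`).
Sums of cutoffs weighted by `ε` give `g j ≥ 0`, flat on `X j` and at least `ε i` at distance
`2^(-i)` or more from `X j` (`exists_flat_ge`). The sum `G` of their pullbacks dominates `f` so
strongly that `f / G` is smooth (`contDiff_div`), and `f = ∑ g j * (f / G)`. -/

/-- The family `c` generates `C`, and `I` is the ideal of relations between its members. -/
structure Presents {C : Type u} [CInfRing C] {n : ℕ} (I : Ideal (CInf n)) (c : Fin n → C) :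
    Prop where
  surj : ∀ x : C, ∃ f : CInf n, x = CInfRing.op f c
  rel : ∀ f g : CInf n, CInfRing.op f c = CInfRing.op g c ↔ f - g ∈ I

section Relations

variable {C : Type u} [CInfRing C] {n : ℕ}

/-- Addition as a smooth function of two variables. -/
def addFun : CInf 2 := CInf.coord 0 + CInf.coord 1

/-- Multiplication as a smooth function of two variables. -/
def mulFun : CInf 2 := CInf.coord 0 * CInf.coord 1

theorem comp_addFun (f g : CInf n) : CInf.comp addFun ![f, g] = f + g := rfl

theorem comp_mulFun (f g : CInf n) : CInf.comp mulFun ![f, g] = f * g := rfl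

/-- `f + g` is the composite of `addFun` with `f, g`, so `op_comp` expresses its value through those
of `f` and `g`; no ring structure on `C` is needed. -/
theorem op_add_congr (c : Fin n → C) {f f' g g' : CInf n}
    (hf : CInfRing.op f c = CInfRing.op f' c) (hg : CInfRing.op g c = CInfRing.op g' c) :
    CInfRing.op (f + g) c = CInfRing.op (f' + g') c := by
  rw [← comp_addFun, ← comp_addFun, CInfRing.op_comp, CInfRing.op_comp]
  congr 1
  funext i
  fin_cases i
  · exact hf
  · exact hg

theorem op_mul_congr (c : Fin n → C) {f f' g g' : CInf n}
    (hf : CInfRing.op f c = CInfRing.op f' c) (hg : CInfRing.op g c = CInfRing.op g' c) :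
    CInfRing.op (f * g) c = CInfRing.op (f' * g') c := by
  rw [← comp_mulFun, ← comp_mulFun, CInfRing.op_comp, CInfRing.op_comp]
  congr 1
  funext i
  fin_cases i
  · exact hf
  · exact hg

/-- The ideal of relations between the members of a family in a `C^∞`-ring. -/
def relIdeal (c : Fin n → C) : Ideal (CInf n) where
  carrier := {f | CInfRing.op f c = CInfRing.op 0 c}
  zero_mem' := rfl
  add_mem' := fun {a b} ha hb => by
    have := op_add_congr c ha hb
    rwa [add_zero] at this
  smul_mem' := fun a b hb => by
    have := op_mul_congr c (rfl : CInfRing.op a c = _) hb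
    rwa [mul_zero] at this

theorem sub_mem_relIdeal (c : Fin n → C) (f g : CInf n) :
    f - g ∈ relIdeal c ↔ CInfRing.op f c = CInfRing.op g c := by
  constructor
  · intro h
    have := op_add_congr c h (rfl : CInfRing.op g c = _)
    rwa [sub_add_cancel, zero_add] at this
  · intro h
    have := op_add_congr c h (rfl : CInfRing.op (-g) c = _)
    rwa [← sub_eq_add_neg, add_neg_cancel] at this

theorem presents_relIdeal {c : Fin n → C} (h : ∀ x : C, ∃ f : CInf n, x = CInfRing.op f c) :
    Presents (relIdeal c) c :=
  ⟨h, fun f g => (sub_mem_relIdeal c f g).symm⟩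

end Relations

namespace Presents

variable {C : Type u} [CInfRing C] {D : Type v} [CInfRing D] {n : ℕ} {I : Ideal (CInf n)}
  {c : Fin n → C}

/-- A morphism out of a presented `C^∞`-ring is given by a family satisfying the relations. -/
noncomputable def lift (hc : Presents I c) (d : Fin n → D) (hd : I ≤ relIdeal d) :
    CInfHom C D where
  toFun x := CInfRing.op (hc.surj x).choose d
  map_op {k} f x := by
    -- Independence of the chosen expression: two expressions of the same element differ by a member
    -- of `I`, so they agree at `d`.
    have key : ∀ g g' : CInf n, CInfRing.op g c = CInfRing.op g' c →
        CInfRing.op g d = CInfRing.op g' d := fun g g' h =>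
      (sub_mem_relIdeal d g g').1 (hd ((hc.rel g g').1 h))
    rw [← CInfRing.op_comp]
    refine key _ _ ?_
    rw [CInfRing.op_comp, ← (hc.surj _).choose_spec]
    congr 1
    funext i
    exact (hc.surj (x i)).choose_spec

theorem lift_op (hc : Presents I c) (d : Fin n → D) (hd : I ≤ relIdeal d) (f : CInf n) :
    (hc.lift d hd).toFun (CInfRing.op f c) = CInfRing.op f d :=
  (sub_mem_relIdeal d _ _).1 (hd ((hc.rel _ _).1 (hc.surj _).choose_spec.symm))

theorem lift_gen (hc : Presents I c) (d : Fin n → D) (hd : I ≤ relIdeal d) (i : Fin n) :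
    (hc.lift d hd).toFun (c i) = d i := by
  rw [← CInfRing.op_coord i c, lift_op, CInfRing.op_coord]

theorem hom_ext (hc : Presents I c) {φ ψ : CInfHom C D} (h : ∀ i, φ.toFun (c i) = ψ.toFun (c i)) :
    φ = ψ := by
  ext x
  obtain ⟨f, rfl⟩ := hc.surj x
  rw [φ.map_op, ψ.map_op]
  congr 1
  exact funext h

theorem le_relIdeal (hc : Presents I c) : I ≤ relIdeal c := fun f hf =>
  (hc.rel f 0).2 (by rwa [sub_zero])

theorem le_relIdeal_map (hc : Presents I c) (φ : CInfHom C D) :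
    I ≤ relIdeal fun i => φ.toFun (c i) := by
  intro f hf
  have h : CInfRing.op f c = CInfRing.op 0 c := hc.le_relIdeal hf
  show CInfRing.op f _ = CInfRing.op 0 _
  rw [← φ.map_op, h, φ.map_op]

theorem map_equiv (hc : Presents I c) (φ : CInfEquiv C D) :
    Presents I fun i => φ.toFun (c i) where
  surj y := by
    obtain ⟨f, hf⟩ := hc.surj (φ.invFun y)
    refine ⟨f, ?_⟩
    rw [← φ.map_op, ← hf]
    exact (φ.right_inv y).symm
  rel f g := by
    rw [← φ.map_op, ← φ.map_op, ← hc.rel]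
    exact φ.injective.eq_iff

/-- Two `C^∞`-rings with the same presentation are isomorphic. -/
noncomputable def equiv (hc : Presents I c) {d : Fin n → D} (hd : Presents I d) :
    CInfEquiv C D where
  toFun := (hc.lift d hd.le_relIdeal).toFun
  invFun := (hd.lift c hc.le_relIdeal).toFun
  left_inv x := by
    obtain ⟨f, rfl⟩ := hc.surj x
    rw [lift_op, lift_op]
  right_inv y := by
    obtain ⟨f, rfl⟩ := hd.surj y
    rw [lift_op, lift_op]
  map_op := (hc.lift d _).map_op

end Presents

theorem presents_quotient {n : ℕ} (I : Ideal (CInf n)) :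
    Presents I fun i => Ideal.Quotient.mk I (CInf.coord i) := by
  have h : ∀ f : CInf n, CInfRing.op f (fun i => Ideal.Quotient.mk I (CInf.coord i)) =
      Ideal.Quotient.mk I f := fun f => quotOp_mk I f CInf.coord
  constructor
  · intro x
    obtain ⟨f, rfl⟩ := Ideal.Quotient.mk_surjective x
    exact ⟨f, (h f).symm⟩
  · intro f g
    rw [h, h]
    exact Ideal.Quotient.eq

/-- The quotients `CInf n ⧸ I` live in `Type`; lifting places them in the universe of a given
diagram. -/
instance (C : Type v) [CInfRing C] : CInfRing (ULift.{u} C) where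
  op f c := ⟨CInfRing.op f fun i => (c i).down⟩
  op_comp g f c := by rw [CInfRing.op_comp]
  op_coord j c := by rw [CInfRing.op_coord]

/-- A `C^∞`-ring is isomorphic to its copies in higher universes. -/
def uliftEquiv (C : Type v) [CInfRing C] : CInfEquiv C (ULift.{u} C) where
  toEquiv := Equiv.ulift.symm
  map_op _ _ := rfl

/-- The `C^∞`-rings which have a finite family of generators whose ideal of relations has the
property `Q`. -/
def HasPresentation (Q : ∀ n : ℕ, Ideal (CInf n) → Prop) : ObjectProperty CInfRingCat.{u} :=
  fun C => ∃ (n : ℕ) (I : Ideal (CInf n)) (c : Fin n → C.carrier), Q n I ∧ Presents I c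

theorem hasPresentation_iff (Q : ∀ n : ℕ, Ideal (CInf n) → Prop) (C : CInfRingCat.{u}) :
    HasPresentation Q C ↔ ∃ (n : ℕ) (I : Ideal (CInf n)), Q n I ∧
      Nonempty (CInfEquiv C.carrier (CInf n ⧸ I)) := by
  constructor
  · rintro ⟨n, I, c, hI, hc⟩
    exact ⟨n, I, hI, ⟨hc.equiv (presents_quotient I)⟩⟩
  · rintro ⟨n, I, hI, ⟨φ⟩⟩
    refine ⟨n, I, _, hI, (presents_quotient I).map_equiv (D := C.carrier)
      { toEquiv := φ.toEquiv.symm, map_op := fun f c => ?_ }⟩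
    apply φ.injective
    refine (φ.right_inv _).trans (Eq.trans ?_ (φ.map_op f _).symm)
    congr 1
    funext i
    exact (φ.right_inv _).symm

/-- Any generating family has an ideal of relations, namely `relIdeal`, so finite generation imposes
no condition on it. -/
theorem isFG_eq : IsFG.{u} = HasPresentation fun _ _ => True := by
  funext C
  refine propext ⟨?_, ?_⟩
  · rintro ⟨n, c, hc⟩
    exact ⟨n, _, c, trivial, presents_relIdeal hc⟩
  · rintro ⟨n, I, c, -, hc⟩
    exact ⟨n, c, hc.surj⟩

theorem isFP_eq : IsFP.{u} = HasPresentation fun _ I => I.FG :=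
  funext fun C => propext (hasPresentation_iff _ C).symm

theorem isGood_eq : IsGood.{u} = HasPresentation fun _ I => IsGoodIdeal I :=
  funext fun C => propext (hasPresentation_iff _ C).symm

theorem HasPresentation.of_iso {Q : ∀ n : ℕ, Ideal (CInf n) → Prop} {C D : CInfRingCat.{u}}
    (h : HasPresentation Q C) (φ : C ≅ D) : HasPresentation Q D := by
  obtain ⟨n, I, c, hI, hc⟩ := h
  refine ⟨n, I, _, hI, hc.map_equiv (D := D.carrier)
    { toFun := φ.hom.toFun
      invFun := φ.inv.toFun
      left_inv := fun x => ?_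
      right_inv := fun x => ?_
      map_op := φ.hom.map_op }⟩
  · exact congrFun (congrArg CInfHom.toFun φ.hom_inv_id) x
  · exact congrFun (congrArg CInfHom.toFun φ.inv_hom_id) x

/-! ### Finite colimits from presentations -/

/-- Pullback of smooth functions along the projection `ℝⁿ → ℝᵐ` selecting coordinates. -/
def pull {m n : ℕ} (e : Fin m → Fin n) : CInf m →+* CInf n where
  toFun f := CInf.comp f fun i => CInf.coord (e i)
  map_zero' := rfl
  map_one' := rfl
  map_add' _ _ := rfl
  map_mul' _ _ := rfl

theorem op_pull {C : Type u} [CInfRing C] {m n : ℕ} (e : Fin m → Fin n) (f : CInf m)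
    (c : Fin n → C) : CInfRing.op (pull e f) c = CInfRing.op f fun i => c (e i) := by
  show CInfRing.op (CInf.comp f _) c = _
  rw [CInfRing.op_comp]
  simp only [CInfRing.op_coord]

/-- A property of ideals inherited by joint ideals of relations in disjoint sets of variables,
enlarged by finitely many relations. -/
def StableUnderGluing (Q : ∀ n : ℕ, Ideal (CInf n) → Prop) : Prop :=
  ∀ (J : Type w) [Finite J] (n : J → ℕ) (N : ℕ) (e : (Σ j, Fin (n j)) ≃ Fin N)
    (I : ∀ j, Ideal (CInf (n j))) (S : Set (CInf N)), S.Finite → (∀ j, Q (n j) (I j)) →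
    Q N (Ideal.span ((⋃ j, pull (fun i => e ⟨j, i⟩) '' (I j : Set (CInf (n j)))) ∪ S))

theorem closedUnderFiniteColimits_hasPresentation {Q : ∀ n : ℕ, Ideal (CInf n) → Prop}
    (hQ : StableUnderGluing.{w} Q) :
    ClosedUnderFiniteColimits.{u, w} (HasPresentation.{u} Q) := by
  intro J _ _ K hK
  choose n I c hI hc using hK
  obtain ⟨N, ⟨e⟩⟩ := Finite.exists_equiv_fin (Σ j, Fin (n j))
  -- `t a i` expresses the image of the `i`-th generator under the arrow `a` in the generators of
  -- the target.
  choose t ht using fun (a : Σ (j j' : J), (j ⟶ j')) (i : Fin (n a.1)) =>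
    (hc a.2.1).surj ((K.map a.2.2).toFun (c a.1 i))
  let p : ∀ j, CInf (n j) →+* CInf N := fun j => pull fun i => e ⟨j, i⟩
  let r : (Σ a : (Σ (j j' : J), (j ⟶ j')), Fin (n a.1)) → CInf N := fun b =>
    CInf.coord (e ⟨b.1.1, b.2⟩) - p b.1.2.1 (t b.1 b.2)
  let T : Ideal (CInf N) := Ideal.span
    ((⋃ j, p j '' (I j : Set (CInf (n j)))) ∪ Set.range r)
  let L : CInfRingCat.{u} := ⟨ULift.{u} (CInf N ⧸ T)⟩
  obtain ⟨q, hq⟩ : ∃ q : Fin N → L.carrier, Presents T q :=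
    ⟨_, (presents_quotient T).map_equiv (uliftEquiv _)⟩
  have hL : HasPresentation Q L :=
    ⟨N, T, q, hQ J n N e I _ (Set.finite_range r) hI, hq⟩
  have hT : ∀ j, I j ≤ relIdeal fun i => q (e ⟨j, i⟩) := fun j f hf => by
    show CInfRing.op f _ = CInfRing.op 0 _
    rw [← op_pull (fun i => e ⟨j, i⟩) f q, ← op_pull (fun i => e ⟨j, i⟩) 0 q, hq.rel, map_zero,
      sub_zero]
    exact Ideal.subset_span (Or.inl (Set.mem_iUnion.2 ⟨j, f, hf, rfl⟩))
  let cc : Cocone K :=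
    { pt := L
      ι :=
        { app := fun j => (hc j).lift _ (hT j)
          naturality := fun j j' a => by
            refine (hc j).hom_ext fun i => ?_
            refine Eq.trans ?_ ((hc j).lift_gen _ (hT j) i).symm
            show ((hc j').lift _ (hT j')).toFun ((K.map a).toFun (c j i)) = _
            rw [ht ⟨j, j', a⟩ i, Presents.lift_op, ← op_pull, ← CInfRing.op_coord (e ⟨j, i⟩) q]
            refine Eq.symm ((hq.rel _ _).2 ?_)
            exact Ideal.subset_span (Or.inr ⟨⟨⟨j, j', a⟩, i⟩, rfl⟩) } }
  -- A cocone yields a family satisfying `T`: the relations of each object hold because the legs are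
  -- morphisms, those in `r` by naturality.
  have hd : ∀ s : Cocone K, ∃ d : Fin N → s.pt.carrier, T ≤ relIdeal d ∧
      ∀ j i, d (e ⟨j, i⟩) = (s.ι.app j).toFun (c j i) := fun s => by
    let w : (Σ j, Fin (n j)) → s.pt.carrier := fun b => (s.ι.app b.1).toFun (c _ b.2)
    let d : Fin N → s.pt.carrier := fun k => w (e.symm k)
    have hde : ∀ j i, d (e ⟨j, i⟩) = (s.ι.app j).toFun (c j i) := fun j i =>
      congrArg w (e.symm_apply_apply ⟨j, i⟩)
    refine ⟨d, Ideal.span_le.2 ?_, hde⟩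
    rintro f (hf | ⟨⟨⟨j, j', a⟩, i⟩, rfl⟩)
    · obtain ⟨j, f, hf', rfl⟩ := Set.mem_iUnion.1 hf
      show CInfRing.op _ d = CInfRing.op 0 d
      rw [← map_zero (p j), op_pull, op_pull]
      simp only [hde]
      exact (hc j).le_relIdeal_map (s.ι.app j) hf'
    · refine (sub_mem_relIdeal d _ _).2 ?_
      rw [CInfRing.op_coord, op_pull]
      simp only [hde]
      rw [← CInfHom.map_op, ← ht ⟨j, j', a⟩ i]
      exact (congrFun (congrArg CInfHom.toFun (s.w a)) (c j i)).symm
  choose d hdT hde using hd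
  have hcc : IsColimit cc :=
    { desc := fun s => hq.lift (d s) (hdT s)
      fac := fun s j => (hc j).hom_ext fun i => by
        show (hq.lift (d s) (hdT s)).toFun (((hc j).lift _ (hT j)).toFun (c j i)) = _
        rw [Presents.lift_gen, Presents.lift_gen, hde]
      uniq := fun s m hm => hq.hom_ext fun k => by
        obtain ⟨⟨j, i⟩, rfl⟩ := e.surjective k
        rw [Presents.lift_gen, hde, ← hm j]
        exact congrArg m.toFun ((hc j).lift_gen _ (hT j) i).symm }
  exact ⟨⟨⟨cc, hcc⟩⟩, fun s ⟨hs⟩ => hL.of_iso (hcc.coconePointUniqueUpToIso hs)⟩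

theorem closedUnderPushouts_hasPresentation {Q : ∀ n : ℕ, Ideal (CInf n) → Prop}
    (hQ : StableUnderGluing.{0} Q) : ClosedUnderPushouts (HasPresentation.{u} Q) := by
  intro C D E α β hC hD hE
  obtain ⟨h1, h2⟩ := closedUnderFiniteColimits_hasPresentation hQ WalkingSpan (span α β) (by rintro (_ | _ | _) <;> assumption)
  exact ⟨h1, fun F γ δ hF => h2 hF.cocone ⟨hF.isColimit⟩⟩

/-! ### Gluing of arbitrary and of finitely generated ideals -/

theorem stableUnderGluing_true : StableUnderGluing.{w} fun _ _ => True :=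
  fun _ _ _ _ _ _ _ _ _ => trivial

theorem stableUnderGluing_fg : StableUnderGluing.{w} fun _ I => I.FG := by
  intro J _ n N e I S hS hI
  rw [Ideal.span_union, Ideal.span_iUnion]
  refine Submodule.FG.sup (Submodule.fg_iSup _ fun j => ?_) (Submodule.fg_span hS)
  exact (hI j).map _

/-! ### Cutoff functions with controlled derivatives -/

section Cutoff

open MeasureTheory Filter
open scoped Convolution Topology

/-- All derivatives fall on `η`, so the bound does not depend on `φ`. The pairing `L` is general
because each differentiation replaces it by `L.precompR E`. -/
theorem norm_iteratedFDeriv_convolution_le {E : Type} [NormedAddCommGroup E] [NormedSpace ℝ E]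
    [FiniteDimensional ℝ E] [MeasurableSpace E] [BorelSpace E] (μ : Measure E)
    [μ.IsAddHaarMeasure] {φ : E → ℝ} (hφ : LocallyIntegrable φ μ) (hφ1 : ∀ x, ‖φ x‖ ≤ 1) (k : ℕ) :
    ∀ {F G : Type} [NormedAddCommGroup F] [NormedSpace ℝ F] [NormedAddCommGroup G]
      [NormedSpace ℝ G] (L : ℝ →L[ℝ] F →L[ℝ] G) {η : E → F}, ContDiff ℝ ∞ η →
      HasCompactSupport η → ∀ x, ‖iteratedFDeriv ℝ k (φ ⋆[L, μ] η) x‖ ≤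
        ‖L‖ * ∫ t, ‖iteratedFDeriv ℝ k η t‖ ∂μ := by
  induction k with
  | zero =>
    intro F G _ _ _ _ L η hη hηc x
    simp only [norm_iteratedFDeriv_zero]
    have hint : Integrable (fun t => ‖η t‖) μ :=
      (hη.continuous.integrable_of_hasCompactSupport hηc).norm
    rw [← integral_sub_left_eq_self (fun t => ‖η t‖) μ x, ← integral_const_mul]
    refine norm_integral_le_of_norm_le ((hint.comp_sub_left x).const_mul _)
      (Eventually.of_forall fun t => ?_)
    refine (L.le_opNorm₂ _ _).trans ?_
    have := mul_le_mul_of_nonneg_left (hφ1 t) (norm_nonneg L)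
    rw [mul_one] at this
    exact mul_le_mul_of_nonneg_right this (norm_nonneg _)
  | succ k ih =>
    intro F G _ _ _ _ L η hη hηc x
    have hd : fderiv ℝ (φ ⋆[L, μ] η) = φ ⋆[L.precompR E, μ] fderiv ℝ η := funext fun y =>
      (hηc.hasFDerivAt_convolution_right L hφ (hη.of_le (by simp)) y).fderiv
    rw [← norm_iteratedFDeriv_fderiv, hd]
    simp only [← norm_iteratedFDeriv_fderiv (f := η)]
    refine (ih (L.precompR E) (hη.fderiv_right (by simp)) (hηc.fderiv ℝ) x).trans ?_
    exact mul_le_mul_of_nonneg_right (L.norm_precompR_le E)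
      (integral_nonneg fun _ => norm_nonneg _)

/-- Convolve the indicator of `B` with one fixed bump of integral one supported in the unit ball;
the constants depend on the bump alone. Closedness serves measurability. -/
theorem exists_smooth_indicator (E : Type) [NormedAddCommGroup E] [NormedSpace ℝ E]
    [FiniteDimensional ℝ E] :
    ∃ C : ℕ → ℝ, ∀ B : Set E, IsClosed B → ∃ u : E → ℝ, ContDiff ℝ ∞ u ∧ (∀ x, 0 ≤ u x) ∧
      (∀ x, (∀ y, dist y x < 1 → y ∈ B) → u x = 1) ∧
      (∀ x, (∀ y, dist y x < 1 → y ∉ B) → u x = 0) ∧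
      ∀ k x, ‖iteratedFDeriv ℝ k u x‖ ≤ C k := by
  borelize E
  let μ : Measure E := Measure.addHaar
  let b : ContDiffBump (0 : E) := ⟨1 / 2, 1, by norm_num, by norm_num⟩
  let η : E → ℝ := b.normed μ
  have hη : ContDiff ℝ ∞ η := b.contDiff_normed
  have hηc : HasCompactSupport η := b.hasCompactSupport_normed
  have hη0 : ∀ x, 1 ≤ ‖x‖ → η x = 0 := fun x hx => by
    by_contra h
    have : x ∈ Function.support η := h
    rw [b.support_normed_eq, mem_ball_zero_iff] at this
    exact absurd this (not_lt.2 hx)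
  let L : ℝ →L[ℝ] ℝ →L[ℝ] ℝ := ContinuousLinearMap.lsmul ℝ ℝ
  refine ⟨fun k => ‖L‖ * ∫ t, ‖iteratedFDeriv ℝ k η t‖ ∂μ, fun B hB => ?_⟩
  let φ : E → ℝ := B.indicator fun _ => 1
  have hφ : LocallyIntegrable φ μ :=
    (locallyIntegrable_const 1).indicator hB.measurableSet
  have hφ1 : ∀ x, ‖φ x‖ ≤ 1 := fun x => by
    by_cases h : x ∈ B <;> simp [φ, h]
  have hu : ∀ x, (φ ⋆[L, μ] η) x = ∫ t, φ t * η (x - t) ∂μ := fun x => rfl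
  refine ⟨φ ⋆[L, μ] η, hηc.contDiff_convolution_right L hφ hη, fun x => ?_, fun x hx => ?_,
    fun x hx => ?_, fun k x => norm_iteratedFDeriv_convolution_le μ hφ hφ1 k L hη hηc x⟩
  · rw [hu]
    refine integral_nonneg fun t => mul_nonneg ?_ (b.nonneg_normed _)
    exact Set.indicator_nonneg (fun _ _ => zero_le_one) _
  · have hone : ∫ t, η (x - t) ∂μ = 1 :=
      (integral_sub_left_eq_self η μ x).trans b.integral_normed
    rw [hu, ← hone]
    refine integral_congr_ae (Eventually.of_forall fun t => ?_)
    by_cases h : dist t x < 1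
    · simp [φ, hx t h]
    · rw [dist_comm, dist_eq_norm, not_lt] at h
      simp [hη0 _ h]
  · rw [hu]
    refine (integral_congr_ae (Eventually.of_forall fun t => ?_)).trans (integral_zero E ℝ)
    by_cases h : dist t x < 1
    · simp [φ, hx t h]
    · rw [dist_comm, dist_eq_norm, not_lt] at h
      simp [hη0 _ h]

theorem exists_cutoff (E : Type) [NormedAddCommGroup E] [NormedSpace ℝ E]
    [FiniteDimensional ℝ E] :
    ∃ C : ℕ → ℝ, ∀ (X : Set E) (δ : ℝ), 0 < δ → ∃ u : E → ℝ, ContDiff ℝ ∞ u ∧ (∀ x, 0 ≤ u x) ∧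
      (∀ x ∉ Metric.thickening δ X, u x = 1) ∧
      (∀ x ∈ Metric.thickening (δ / 4) X, u x = 0) ∧
      ∀ k x, ‖iteratedFDeriv ℝ k u x‖ ≤ C k * δ⁻¹ ^ k := by
  obtain ⟨C, hC⟩ := exists_smooth_indicator E
  refine ⟨fun k => C k * 4 ^ k, fun X δ hδ => ?_⟩
  have hδ4 : 0 < δ / 4 := by positivity
  -- At scale `δ / 4` the smoothing looks only at points within `δ / 4`: the value is 1 off the
  -- `δ`-thickening as `δ/2 + δ/4 < δ`, and 0 in the `δ/4`-thickening as `δ/4 + δ/4 = δ/2`.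
  obtain ⟨u, hu, hu0, hu1, hu2, huC⟩ := hC {y | (δ / 4) • y ∉ Metric.thickening (δ / 2) X}
    ((Metric.isOpen_thickening.preimage (continuous_const_smul (δ / 4))).isClosed_compl)
  have hdist : ∀ x y : E, dist y ((δ / 4)⁻¹ • x) < 1 → dist ((δ / 4) • y) x < δ / 4 := by
    intro x y h
    have h1 : dist ((δ / 4) • y) ((δ / 4) • (δ / 4)⁻¹ • x) = δ / 4 * dist y ((δ / 4)⁻¹ • x) := by
      rw [dist_smul₀, Real.norm_of_nonneg hδ4.le]
    rw [smul_inv_smul₀ hδ4.ne'] at h1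
    rw [h1]
    exact mul_lt_of_lt_one_right hδ4 h
  refine ⟨fun x => u ((δ / 4)⁻¹ • x), hu.comp (contDiff_const_smul _), fun x => hu0 _,
    fun x hx => hu1 _ fun y hy => ?_, fun x hx => hu2 _ fun y hy => ?_, fun k x => ?_⟩
  · intro h
    obtain ⟨w, hw, hyw⟩ := Metric.mem_thickening_iff.1 h
    refine hx (Metric.mem_thickening_iff.2 ⟨w, hw, ?_⟩)
    have := hdist x y hy
    have := dist_triangle_left x w ((δ / 4) • y)
    linarith
  · obtain ⟨w, hw, hxw⟩ := Metric.mem_thickening_iff.1 hx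
    refine not_not.2 (Metric.mem_thickening_iff.2 ⟨w, hw, ?_⟩)
    have := hdist x y hy
    have := dist_triangle ((δ / 4) • y) x w
    linarith
  · rw [iteratedFDeriv_comp_const_smul _ (hu.of_le (by exact_mod_cast le_top)), norm_smul,
      norm_pow, Real.norm_of_nonneg (inv_nonneg.2 hδ4.le)]
    have h4 : (δ / 4)⁻¹ = 4 * δ⁻¹ := by field_simp
    rw [h4, mul_pow, mul_comm]
    refine (mul_le_mul_of_nonneg_right (huC k _) (by positivity)).trans (le_of_eq ?_)
    ring

/-- A nonnegative smooth function, flat on `X`, with prescribed lower bounds off the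
neighbourhoods of `X`. -/
theorem exists_flat_ge {E : Type} [NormedAddCommGroup E] [NormedSpace ℝ E]
    [FiniteDimensional ℝ E] (X : Set E) (ε : ℕ → ℝ) (hε : ∀ i, 0 < ε i)
    (hs : ∀ k : ℕ, Summable fun i => ε i * (2 ^ i) ^ k) :
    ∃ g : E → ℝ, ContDiff ℝ ∞ g ∧ (∀ x, 0 ≤ g x) ∧
      (∀ x ∈ X, ∀ k, iteratedFDeriv ℝ k g x = 0) ∧
      ∀ i, ∀ x ∉ Metric.thickening ((1 / 2) ^ i) X, ε i ≤ g x := by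
  obtain ⟨C, hC⟩ := exists_cutoff E
  choose u hu hu0 hu1 hu2 huC using fun i : ℕ => hC X ((1 / 2) ^ i) (by positivity)
  let f : ℕ → E → ℝ := fun i x => ε i • u i x
  have hf : ∀ i, ContDiff ℝ ∞ (f i) := fun i => (hu i).const_smul (ε i)
  have hfk : ∀ (k i : ℕ) (x : E), iteratedFDeriv ℝ k (f i) x =
      ε i • iteratedFDeriv ℝ k (u i) x := fun k i x =>
    iteratedFDeriv_const_smul_apply' ((hu i).of_le (by exact_mod_cast le_top)).contDiffAt
  have hv : ∀ k : ℕ, Summable fun i => C k * (ε i * (2 ^ i) ^ k) := fun k => (hs k).mul_left _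
  have hb : ∀ (k i : ℕ) (x : E), ‖iteratedFDeriv ℝ k (f i) x‖ ≤ C k * (ε i * (2 ^ i) ^ k) := by
    intro k i x
    rw [hfk, norm_smul, Real.norm_of_nonneg (hε i).le]
    refine (mul_le_mul_of_nonneg_left (huC i k x) (hε i).le).trans (le_of_eq ?_)
    have h2 : ((1 / 2 : ℝ) ^ i)⁻¹ = 2 ^ i := by simp
    rw [h2]
    ring
  have hsum : ∀ x, Summable fun i => f i x := fun x =>
    Summable.of_norm_bounded (hv 0) fun i => by
      have := hb 0 i x
      rwa [norm_iteratedFDeriv_zero] at this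
  have hf0 : ∀ i x, 0 ≤ f i x := fun i x => mul_nonneg (hε i).le (hu0 i x)
  refine ⟨fun x => ∑' i, f i x, contDiff_tsum (N := ⊤) hf (fun k _ => hv k)
    fun k i x _ => hb k i x, fun x => tsum_nonneg fun i => hf0 i x, fun x hx k => ?_,
    fun i x hx => ?_⟩
  · rw [iteratedFDeriv_tsum (N := ⊤) hf (fun k _ => hv k) (fun k i x _ => hb k i x) le_top]
    refine (tsum_congr fun i => ?_).trans tsum_zero
    -- Each cutoff vanishes on a whole neighbourhood of `x`, hence so do all its derivatives there.
    have hev : u i =ᶠ[𝓝 x] fun _ => 0 := by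
      filter_upwards [Metric.isOpen_thickening.mem_nhds
        (Metric.self_subset_thickening (δ := (1 / 2 : ℝ) ^ i / 4) (by positivity) X hx)] with y hy
      exact hu2 i y hy
    rw [hfk, (hev.iteratedFDeriv ℝ k).eq_of_nhds]
    simp
  · have h1 : f i x = ε i := by simp [f, hu1 i x hx]
    rw [← h1]
    exact (hsum x).le_tsum i fun j _ => hf0 j x

end Cutoff

/-! ### Division of flat functions -/

section Division

open Filter Asymptotics
open scoped Topology

variable {E : Type} [NormedAddCommGroup E] [NormedSpace ℝ E]

/-- All derivatives of `f` vanish faster than every power of `G` at the zeros of `G`. -/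
structure FlatAlong {F : Type} [NormedAddCommGroup F] [NormedSpace ℝ F] (G : E → ℝ)
    (f : E → F) : Prop where
  smooth : ContDiff ℝ ∞ f
  isBigO : ∀ z, G z = 0 → ∀ k p : ℕ, iteratedFDeriv ℝ k f =O[𝓝 z] fun y => G y ^ p

namespace FlatAlong

variable {F : Type} [NormedAddCommGroup F] [NormedSpace ℝ F] {G : E → ℝ} {f : E → F}

theorem isBigO_self (hf : FlatAlong G f) {z : E} (hz : G z = 0) (p : ℕ) :
    f =O[𝓝 z] fun y => G y ^ p := by
  refine IsBigO.of_norm_left ?_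
  have := (hf.isBigO z hz 0 p).norm_left
  simpa only [norm_iteratedFDeriv_zero] using this

theorem fderiv (hf : FlatAlong G f) : FlatAlong G (fderiv ℝ f) where
  smooth := hf.smooth.fderiv_right (by simp)
  isBigO z hz k p := by
    refine IsBigO.of_norm_left ?_
    simp only [norm_iteratedFDeriv_fderiv]
    exact (hf.isBigO z hz (k + 1) p).norm_left

/-- Differentiating `G⁻ʳ f` produces `f` multiplied by `dG`; the Leibniz bound keeps that term flat.
-/
theorem smulRight (hf : FlatAlong G f) {a : E → E →L[ℝ] ℝ} (ha : ContDiff ℝ ∞ a) :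
    FlatAlong G fun z => (a z).smulRight (f z) where
  smooth := ha.smulRight hf.smooth
  isBigO z hz k p := by
    have hle : ∀ y, ‖iteratedFDeriv ℝ k (fun z => (a z).smulRight (f z)) y‖ ≤
        ∑ i ∈ Finset.range (k + 1), (k.choose i : ℝ) * ‖iteratedFDeriv ℝ i a y‖ *
          ‖iteratedFDeriv ℝ (k - i) f y‖ := fun y =>
      ContinuousLinearMap.norm_iteratedFDeriv_le_of_bilinear_of_le_one
        (ContinuousLinearMap.smulRightL ℝ E F) ha hf.smooth y (by exact_mod_cast le_top)
        ContinuousLinearMap.norm_smulRightL_le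
    refine IsBigO.trans (g := fun y => ∑ i ∈ Finset.range (k + 1),
      (k.choose i : ℝ) * ‖iteratedFDeriv ℝ i a y‖ * ‖iteratedFDeriv ℝ (k - i) f y‖)
      (IsBigO.of_norm_le hle) (IsBigO.fun_sum fun i _ => ?_)
    have h1 : (fun y => (k.choose i : ℝ) * ‖iteratedFDeriv ℝ i a y‖) =O[𝓝 z]
        fun _ => (1 : ℝ) :=
      IsBigO.const_mul_left ((ha.continuous_iteratedFDeriv
        (by exact_mod_cast le_top)).norm.continuousAt.isBigO_one ℝ) _
    simpa only [one_mul] using h1.mul (hf.isBigO z hz (k - i) p).norm_left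

/-- Off the zeros of `G` this is the quotient rule. At a zero, `f = O(G^(r+2))` makes the function
`O(G²) = o(y - z)`, so its derivative is 0; the formula also gives 0, since `f` and its derivative
vanish there. -/
theorem hasFDerivAt_inv_pow_smul (hf : FlatAlong G f) (hG : ContDiff ℝ ∞ G) (r : ℕ) (z : E) :
    HasFDerivAt (fun y => (G y ^ r)⁻¹ • f y)
      ((G z ^ r)⁻¹ • _root_.fderiv ℝ f z -
        (r : ℝ) • (G z ^ (r + 1))⁻¹ • (_root_.fderiv ℝ G z).smulRight (f z)) z := by
  have hGd : HasFDerivAt G (_root_.fderiv ℝ G z) z :=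
    (hG.differentiable (by simp) z).hasFDerivAt
  have hfd : HasFDerivAt f (_root_.fderiv ℝ f z) z :=
    (hf.smooth.differentiable (by simp) z).hasFDerivAt
  by_cases hz : G z = 0
  · have hzero : ∀ {H : Type} [NormedAddCommGroup H] [NormedSpace ℝ H] {h : E → H},
        FlatAlong G h → h z = 0 := fun hh => by
      obtain ⟨c, hc⟩ := (hh.isBigO_self hz 1).bound
      have := hc.self_of_nhds
      rw [hz] at this
      simpa using this
    have hsq : (fun y => G y ^ 2) =o[𝓝 z] fun y => y - z := by
      have := (hGd.pow 2).isLittleO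
      simpa [hz] using this
    have hO : (fun y => (G y ^ r)⁻¹ • f y) =O[𝓝 z] fun y => G y ^ 2 := by
      obtain ⟨c, hc⟩ := (hf.isBigO_self hz (r + 2)).bound
      refine IsBigO.of_bound c ?_
      filter_upwards [hc] with y hy
      by_cases hy0 : G y = 0
      · rw [hy0] at hy ⊢
        have : f y = 0 := by simpa using hy
        simp [this]
      · have hpos : 0 < ‖G y ^ r‖ := norm_pos_iff.2 (pow_ne_zero _ hy0)
        rw [norm_smul, norm_inv, inv_mul_le_iff₀ hpos]
        refine hy.trans (le_of_eq ?_)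
        rw [pow_add, norm_mul]
        ring
    rw [hzero hf, hzero hf.fderiv]
    have := hO.trans_isLittleO hsq
    rw [hasFDerivAt_iff_isLittleO]
    simpa [hzero hf] using this
  · have h1 := (hasDerivAt_inv (pow_ne_zero r hz)).comp_hasFDerivAt z (hGd.pow r)
    refine (h1.smul hfd).congr_fderiv ?_
    ext v
    rcases r with _ | r
    · simp
    · simp only [add_apply, smul_apply,
        ContinuousLinearMap.smulRight_apply, smul_smul, smul_eq_mul, sub_eq_add_neg, ← neg_smul]
      congr 2
      simp
      field_simp
      exact Or.inl (by ring)

/-- The derivative consists of terms of the same shape, with new flat functions and exponents `r`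
and `r + 1`; hence the induction runs over all `F`, `f` and `r` at once. -/
theorem contDiff_inv_pow_smul (hG : ContDiff ℝ ∞ G) (m : ℕ) :
    ∀ {F : Type} [NormedAddCommGroup F] [NormedSpace ℝ F] {f : E → F}, FlatAlong G f →
      ∀ r : ℕ, ContDiff ℝ m fun y => (G y ^ r)⁻¹ • f y := by
  induction m with
  | zero =>
    intro F _ _ f hf r
    exact contDiff_zero.2 (continuous_iff_continuousAt.2 fun x =>
      (hf.hasFDerivAt_inv_pow_smul hG r x).continuousAt)
  | succ m ih =>
    intro F _ _ f hf r
    rw [Nat.cast_succ]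
    refine contDiff_succ_iff_fderiv.2 ⟨fun x =>
      (hf.hasFDerivAt_inv_pow_smul hG r x).differentiableAt,
      fun h => absurd h (WithTop.coe_ne_top (a := (m : ℕ∞))), ?_⟩
    rw [funext fun x => (hf.hasFDerivAt_inv_pow_smul hG r x).fderiv]
    exact (ih hf.fderiv r).sub
      ((ih (hf.smulRight (hG.fderiv_right (m := ∞) (by simp))) (r + 1)).const_smul (r : ℝ))

theorem contDiff_div {f : E → ℝ} (hf : FlatAlong G f) (hG : ContDiff ℝ ∞ G) :
    ContDiff ℝ ∞ fun y => f y / G y := by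
  refine contDiff_infty.2 fun m => ?_
  have := contDiff_inv_pow_smul hG m hf 1
  simpa only [pow_one, smul_eq_mul, inv_mul_eq_div] using this

end FlatAlong

/-! ### Rates of decay of flat functions -/

/-- The `k`-th derivative vanishes at `w`, so the mean value inequality on the segment from `w` to
`z` turns the bound for order `k + 1` into one for order `k` with an extra factor `dist z w`. -/
theorem exists_norm_iteratedFDeriv_le [FiniteDimensional ℝ E] {f : E → ℝ} (hf : ContDiff ℝ ∞ f)
    {Z : Set E} (hZ : ∀ z ∈ Z, ∀ k, iteratedFDeriv ℝ k f z = 0) (R : ℝ) (p : ℕ) :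
    ∀ k : ℕ, ∃ C, ∀ z ∈ Metric.closedBall (0 : E) R, ∀ w ∈ Metric.closedBall (0 : E) R, w ∈ Z →
      ‖iteratedFDeriv ℝ k f z‖ ≤ C * dist z w ^ p := by
  induction p with
  | zero =>
    intro k
    obtain ⟨C, hC⟩ := (isCompact_closedBall (0 : E) R).exists_bound_of_continuousOn
      (hf.continuous_iteratedFDeriv (m := k) (by exact_mod_cast le_top)).continuousOn
    exact ⟨C, fun z hz w _ _ => by simpa using hC z hz⟩
  | succ p ih =>
    intro k
    obtain ⟨C, hC⟩ := ih (k + 1)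
    refine ⟨C, fun z hz w hw hwZ => ?_⟩
    have hC0 : 0 ≤ C * dist z w ^ p := (norm_nonneg _).trans (hC z hz w hw hwZ)
    have hsub : segment ℝ w z ⊆ Metric.closedBall (0 : E) R :=
      (convex_closedBall _ _).segment_subset hw hz
    have key := (convex_segment w z).norm_image_sub_le_of_norm_fderiv_le
      (f := iteratedFDeriv ℝ k f) (𝕜 := ℝ) (C := C * dist z w ^ p)
      (fun x _ => (hf.differentiable_iteratedFDeriv (m := k)
        (by exact_mod_cast ENat.natCast_lt_top k)) x)
      (fun x hx => by
        rw [norm_fderiv_iteratedFDeriv]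
        -- The sign of `C` can be read off the bound only after dividing by a positive distance.
        rcases eq_or_ne z w with rfl | hne
        · have : x = z := by simpa using hx
          rw [this]
          exact hC z hz z hz hwZ
        · have hCn : 0 ≤ C := nonneg_of_mul_nonneg_left hC0 (pow_pos (dist_pos.2 hne) p)
          refine (hC x (hsub hx) w hw hwZ).trans (mul_le_mul_of_nonneg_left ?_ hCn)
          refine pow_le_pow_left₀ dist_nonneg ?_ p
          have := dist_add_dist_of_mem_segment hx
          rw [dist_comm z w, dist_comm x w]
          linarith [dist_nonneg (x := x) (y := z)])
      (left_mem_segment ℝ w z) (right_mem_segment ℝ w z)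
    rw [hZ w hwZ, sub_zero, ← dist_eq_norm, mul_assoc, ← pow_succ] at key
    exact key

/-- Take for `q i` the largest `N ≤ i` such that `S N` holds from `i` on; every fixed `N` eventually
qualifies. -/
theorem exists_tendsto_diagonal {S : ℕ → ℕ → Prop} (hS : ∀ N, ∀ᶠ i in atTop, S N i) :
    ∃ q : ℕ → ℕ, Tendsto q atTop atTop ∧ ∀ᶠ i in atTop, S (q i) i := by
  classical
  let P : ℕ → ℕ → Prop := fun i N => ∀ j ≥ i, S N j
  refine ⟨fun i => Nat.findGreatest (P i) i, tendsto_atTop.2 fun N => ?_, ?_⟩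
  · obtain ⟨i₀, hi₀⟩ := eventually_atTop.1 (hS N)
    filter_upwards [eventually_ge_atTop i₀, eventually_ge_atTop N] with i hi hN
    exact Nat.le_findGreatest hN fun j hj => hi₀ j (hi.trans hj)
  -- `Nat.findGreatest` defaults to 0, so `P i 0` is needed for its value to satisfy `P i`.
  · obtain ⟨i₀, hi₀⟩ := eventually_atTop.1 (hS 0)
    filter_upwards [eventually_ge_atTop i₀] with i hi
    exact Nat.findGreatest_spec (P := P i) (Nat.zero_le i) (fun j hj => hi₀ j (hi.trans hj)) i
      le_rfl

/-- A sequence which decreases faster than geometrically, but slowly when compared with a given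
flat function. -/
theorem exists_slow_sequence [FiniteDimensional ℝ E] {f : E → ℝ} (hf : ContDiff ℝ ∞ f)
    {Z : Set E} (hZ : ∀ z ∈ Z, ∀ k, iteratedFDeriv ℝ k f z = 0) :
    ∃ ε : ℕ → ℝ, (∀ i, 0 < ε i) ∧ (∀ k : ℕ, Summable fun i => ε i * (2 ^ i) ^ k) ∧
      ∀ (k p : ℕ) (R : ℝ), ∀ᶠ i in atTop, ∀ z ∈ Metric.closedBall (0 : E) R,
        z ∈ Metric.thickening ((1 / 2) ^ i) Z → ‖iteratedFDeriv ℝ k f z‖ ≤ ε (i + 1) ^ p := by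
  let S : ℕ → ℕ → Prop := fun N i => ∀ k ≤ N, ∀ z ∈ Metric.closedBall (0 : E) N,
    z ∈ Metric.thickening ((1 / 2) ^ i) Z →
      ‖iteratedFDeriv ℝ k f z‖ ≤ (1 / 2) ^ ((i + 1) * N * N)
  have hS : ∀ N, ∀ᶠ i in atTop, S N i := by
    intro N
    have : ∀ k ∈ Finset.range (N + 1), ∀ᶠ i : ℕ in atTop,
        ∀ z ∈ Metric.closedBall (0 : E) N, z ∈ Metric.thickening ((1 / 2) ^ i) Z →
          ‖iteratedFDeriv ℝ k f z‖ ≤ (1 / 2) ^ ((i + 1) * N * N) := by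
      intro k _
      -- The spare factor `2^(-i)` beyond the power `N * N` absorbs `C` and the passage from `i` to
      -- `i + 1`. Radius `N + 1` leaves room for a nearby point of `Z`.
      obtain ⟨C, hC⟩ := exists_norm_iteratedFDeriv_le hf hZ (N + 1) (N * N + 1) k
      have hlim : Tendsto (fun i : ℕ => |C| * (1 / 2 : ℝ) ^ i) atTop (𝓝 0) := by
        simpa using (tendsto_pow_atTop_nhds_zero_of_lt_one (r := (1 / 2 : ℝ)) (by norm_num)
          (by norm_num)).const_mul |C|
      filter_upwards [hlim.eventually_le_const
        (show (0 : ℝ) < (1 / 2) ^ (N * N) by positivity)] with i hi z hz hzZ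
      obtain ⟨w, hwZ, hzw⟩ := Metric.mem_thickening_iff.1 hzZ
      rw [mem_closedBall_zero_iff] at hz
      have hle1 : (1 / 2 : ℝ) ^ i ≤ 1 := pow_le_one₀ (by norm_num) (by norm_num)
      have hw : w ∈ Metric.closedBall (0 : E) (N + 1) := by
        rw [mem_closedBall_zero_iff]
        have := norm_le_norm_add_norm_sub z w
        rw [← dist_eq_norm] at this
        linarith
      calc ‖iteratedFDeriv ℝ k f z‖ ≤ C * dist z w ^ (N * N + 1) :=
            hC z (mem_closedBall_zero_iff.2 (by linarith)) w hw hwZ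
        _ ≤ |C| * ((1 / 2) ^ i) ^ (N * N + 1) :=
            mul_le_mul (le_abs_self C) (pow_le_pow_left₀ dist_nonneg hzw.le _)
              (by positivity) (abs_nonneg C)
        _ = |C| * (1 / 2) ^ i * ((1 / 2) ^ i) ^ (N * N) := by ring
        _ ≤ (1 / 2) ^ (N * N) * ((1 / 2) ^ i) ^ (N * N) :=
            mul_le_mul_of_nonneg_right hi (by positivity)
        _ = (1 / 2) ^ ((i + 1) * N * N) := by
            rw [← pow_mul, ← pow_add]
            congr 1
            ring
    filter_upwards [(Filter.eventually_all_finset _).2 this] with i hi k hk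
    exact hi k (Finset.mem_range.2 (by omega))
  obtain ⟨q, hq, hSq⟩ := exists_tendsto_diagonal hS
  -- The shift makes `ε (i + 1) = 2^(-(i+1) q i)`, so `S (q i) i` bounds the derivatives by `ε (i +
  -- 1) ^ q i`. The truncation at `i = 0` is harmless: `ε 0 = 1`. Summability follows from `q → ∞`.
  refine ⟨fun i => (1 / 2) ^ (i * q (i - 1)), fun i => by positivity, fun k => ?_,
    fun k p R => ?_⟩
  · refine Summable.of_norm_bounded_eventually_nat (g := fun i => (1 / 2 : ℝ) ^ i)
      (summable_geometric_of_lt_one (by norm_num) (by norm_num)) ?_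
    filter_upwards [(hq.comp (tendsto_sub_atTop_nat 1)).eventually_ge_atTop (k + 1)] with i hi
    rw [Real.norm_of_nonneg (by positivity)]
    have h2 : (2 ^ i : ℝ) ^ k = ((1 / 2) ^ (i * k))⁻¹ := by
      rw [one_div, inv_pow, inv_inv, pow_mul]
    rw [h2, mul_inv_le_iff₀ (by positivity), ← pow_add]
    refine pow_le_pow_of_le_one (by norm_num) (by norm_num) ?_
    calc i + i * k = i * (k + 1) := by ring
      _ ≤ i * q (i - 1) := Nat.mul_le_mul_left i hi
  · obtain ⟨N, hN⟩ := exists_nat_ge R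
    filter_upwards [hSq, hq.eventually_ge_atTop k, hq.eventually_ge_atTop p,
      hq.eventually_ge_atTop N] with i hi hk hp hNi z hz hzZ
    refine (hi k hk z (Metric.closedBall_subset_closedBall
      (hN.trans (by exact_mod_cast hNi)) hz) hzZ).trans ?_
    rw [Nat.add_sub_cancel, ← pow_mul]
    exact pow_le_pow_of_le_one (by norm_num) (by norm_num) (Nat.mul_le_mul_left _ hp)

/-- For `y ∉ Z` take the first `i` with `y` outside the `2^(-i)`-thickening. Then `G y ≥ ε i`, while
`y` still lies in the preceding thickening, where the derivatives of `f` are at most `ε i ^ p`;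
hence the index `i + 1` in `hεf`. -/
theorem flatAlong_of_ge [FiniteDimensional ℝ E] {f G : E → ℝ} (hf : ContDiff ℝ ∞ f) {Z : Set E}
    (hZc : IsClosed Z) (hZ : ∀ z ∈ Z, ∀ k, iteratedFDeriv ℝ k f z = 0) {ε : ℕ → ℝ}
    (hε : ∀ i, 0 < ε i)
    (hεf : ∀ (k p : ℕ) (R : ℝ), ∀ᶠ i in atTop, ∀ z ∈ Metric.closedBall (0 : E) R,
        z ∈ Metric.thickening ((1 / 2) ^ i) Z → ‖iteratedFDeriv ℝ k f z‖ ≤ ε (i + 1) ^ p)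
    (hG0 : ∀ z, 0 ≤ G z) (hG : ∀ i, ∀ z ∉ Metric.thickening ((1 / 2) ^ i) Z, ε i ≤ G z) :
    FlatAlong G f := by
  classical
  have hlev : ∀ z ∉ Z, ∃ i : ℕ, z ∉ Metric.thickening ((1 / 2) ^ i) Z := by
    intro z hz
    by_contra! h
    refine hz (hZc.closure_eq ▸ Metric.mem_closure_iff.2 fun δ hδ => ?_)
    obtain ⟨i, hi⟩ := exists_pow_lt_of_lt_one hδ (by norm_num : (1 / 2 : ℝ) < 1)
    obtain ⟨w, hw, hzw⟩ := Metric.mem_thickening_iff.1 (h i)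
    exact ⟨w, hw, hzw.trans hi⟩
  refine ⟨hf, fun z hz k p => ?_⟩
  have hzZ : z ∈ Z := by
    by_contra h
    obtain ⟨i, hi⟩ := hlev z h
    exact absurd (hG i z hi) (not_le.2 (hz ▸ hε i))
  obtain ⟨i₀, hi₀⟩ := eventually_atTop.1 (hεf k p (‖z‖ + 1))
  refine IsBigO.of_bound 1 ?_
  filter_upwards [Metric.ball_mem_nhds z one_pos, Metric.isOpen_thickening.mem_nhds
    (Metric.self_subset_thickening (δ := (1 / 2 : ℝ) ^ i₀) (by positivity) Z hzZ)] with y hy hyi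
  rw [one_mul, Real.norm_of_nonneg (pow_nonneg (hG0 y) p)]
  by_cases hyZ : y ∈ Z
  · rw [hZ y hyZ, norm_zero]
    exact pow_nonneg (hG0 y) p
  have hyR : y ∈ Metric.closedBall (0 : E) (‖z‖ + 1) := by
    rw [mem_closedBall_zero_iff]
    have := norm_le_norm_add_norm_sub' y z
    rw [Metric.mem_ball, dist_eq_norm] at hy
    linarith
  have hi := Nat.find_spec (hlev y hyZ)
  set i := Nat.find (hlev y hyZ) with hidef
  -- Closeness of `y` to `z ∈ Z` forces `i` to be large, and in particular to have a predecessor.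
  have hii : i₀ < i := by
    by_contra h
    refine hi (Metric.thickening_mono ?_ _ hyi)
    exact pow_le_pow_of_le_one (by norm_num) (by norm_num) (not_lt.1 h)
  obtain ⟨l, hl⟩ : ∃ l, i = l + 1 := ⟨i - 1, by omega⟩
  have hyl : y ∈ Metric.thickening ((1 / 2) ^ l) Z :=
    not_not.1 (Nat.find_min (hlev y hyZ) (show l < Nat.find (hlev y hyZ) by omega))
  rw [hl] at hi
  exact (hi₀ l (by omega) y hyR hyl).trans
    (pow_le_pow_left₀ (hε _).le (hG _ y hi) p)

end Division

/-! ### Ideals of flat functions on products -/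

theorem pull_mem_flatIdeal {m n : ℕ} (e : Fin m → Fin n) {X : Set (Fin m → ℝ)}
    {Z : Set (Fin n → ℝ)} (h : ∀ z ∈ Z, (fun i => z (e i)) ∈ X) {g : CInf m}
    (hg : g ∈ flatIdeal X) : pull e g ∈ flatIdeal Z := by
  intro z hz k
  let A : (Fin n → ℝ) →L[ℝ] (Fin m → ℝ) :=
    ContinuousLinearMap.pi fun i => ContinuousLinearMap.proj (e i)
  have hA : (pull e g).1 = g.1 ∘ A := rfl
  rw [hA, A.iteratedFDeriv_comp_right g.smooth z (by exact_mod_cast le_top)]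
  have : iteratedFDeriv ℝ k g.1 (A z) = 0 := hg _ (h z hz) k
  rw [this]
  rfl

section Product

variable {J : Type w} {n : J → ℕ} {N : ℕ} (e : (Σ j, Fin (n j)) ≃ Fin N)
  (X : ∀ j, Set (Fin (n j) → ℝ))

/-- The product of the sets `X j`, in `ℝᴺ`. -/
def prodSet : Set (Fin N → ℝ) := {z | ∀ j, (fun i => z (e ⟨j, i⟩)) ∈ X j}

theorem isClosed_prodSet {X : ∀ j, Set (Fin (n j) → ℝ)} (hX : ∀ j, IsClosed (X j)) :
    IsClosed (prodSet e X) := by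
  have : prodSet e X = ⋂ j, (fun (z : Fin N → ℝ) i => z (e ⟨j, i⟩)) ⁻¹' X j := by
    ext z
    simp [prodSet]
  rw [this]
  exact isClosed_iInter fun j => (hX j).preimage (by fun_prop)

/-- In the sup metric, nearby points chosen in each factor assemble to a nearby point of the
product. -/
theorem exists_notMem_thickening {δ : ℝ} (hδ : 0 < δ) {z : Fin N → ℝ}
    (hz : z ∉ Metric.thickening δ (prodSet e X)) :
    ∃ j, (fun i => z (e ⟨j, i⟩)) ∉ Metric.thickening δ (X j) := by
  by_contra! h
  choose w hw hzw using fun j => Metric.mem_thickening_iff.1 (h j)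
  let W : (Σ j, Fin (n j)) → ℝ := fun b => w b.1 b.2
  have hW : ∀ b, W (e.symm (e b)) = W b := fun b => congrArg W (e.symm_apply_apply b)
  refine hz (Metric.mem_thickening_iff.2 ⟨fun k => W (e.symm k), fun j => ?_,
    (dist_pi_lt_iff hδ).2 fun k => ?_⟩)
  · rw [funext fun i => hW ⟨j, i⟩]
    exact hw j
  · obtain ⟨⟨j, i⟩, rfl⟩ := e.surjective k
    rw [hW]
    exact (dist_pi_lt_iff hδ).1 (hzw j) i

theorem flatIdeal_prodSet [Finite J] {X : ∀ j, Set (Fin (n j) → ℝ)} (hX : ∀ j, IsClosed (X j)) :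
    flatIdeal (prodSet e X) =
      ⨆ j, (flatIdeal (X j)).map (pull fun i => e ⟨j, i⟩) := by
  refine le_antisymm (fun f hf => ?_) (iSup_le fun j => Ideal.map_le_iff_le_comap.2 fun g hg =>
    pull_mem_flatIdeal _ (fun z (hz : z ∈ prodSet e X) => hz j) hg)
  cases nonempty_fintype J
  obtain ⟨ε, hε, hs, hεf⟩ := exists_slow_sequence f.smooth hf
  -- The same `ε`, dictated by `f`, serves every factor, so that `G` inherits the lower bounds
  -- around the product.
  choose g hg hg0 hgX hgε using fun j => exists_flat_ge (X j) ε hε hs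
  let γ : ∀ j, CInf (n j) := fun j => CInf.mk (g j) (hg j)
  let G : CInf N := ∑ j, pull (fun i => e ⟨j, i⟩) (γ j)
  have hG : ∀ z, G.1 z = ∑ j, g j fun i => z (e ⟨j, i⟩) := fun z => by
    simp only [G, AddSubmonoidClass.coe_finsetSum, Finset.sum_apply]
    rfl
  have hflat : FlatAlong G.1 f.1 := by
    refine flatAlong_of_ge f.smooth (isClosed_prodSet e hX) hf hε hεf
      (fun z => ?_) fun i z hz => ?_
    · rw [hG]
      exact Finset.sum_nonneg fun j _ => hg0 j _
    · rw [hG]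
      obtain ⟨j, hj⟩ := exists_notMem_thickening e X (by positivity) hz
      exact (hgε j i _ hj).trans (Finset.single_le_sum
        (f := fun j => g j fun i => z (e ⟨j, i⟩)) (fun j _ => hg0 j _) (Finset.mem_univ j))
  have hGf : ∀ z, G.1 z = 0 → f.1 z = 0 := fun z hz => by
    obtain ⟨c, hc⟩ := (hflat.isBigO_self hz 1).bound
    have := hc.self_of_nhds
    rw [hz] at this
    simpa using this
  let h : CInf N := CInf.mk _ (hflat.contDiff_div G.smooth)
  have hfG : f = ∑ j, pull (fun i => e ⟨j, i⟩) (γ j) * h := by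
    rw [← Finset.sum_mul]
    refine Subtype.ext (funext fun z => ?_)
    show f.1 z = G.1 z * (f.1 z / G.1 z)
    by_cases hz : G.1 z = 0
    · rw [hz, zero_mul, hGf z hz]
    · rw [mul_div_cancel₀ _ hz]
  rw [hfG]
  refine Ideal.sum_mem _ fun j _ => Ideal.mul_mem_right _ _ ?_
  exact Ideal.mem_iSup_of_mem j (Ideal.mem_map_of_mem _ (hgX j))

end Product

/-- The finitely many explicit generators are collected in `T`; the flat parts combine into the
single flat ideal of the product by `flatIdeal_prodSet`. -/
theorem stableUnderGluing_good : StableUnderGluing.{w} fun _ I => IsGoodIdeal I := by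
  intro J _ n N e I S hS hI
  choose k f X hX hI using hI
  let T : Set (CInf N) := (⋃ j, pull (fun i => e ⟨j, i⟩) '' Set.range (f j)) ∪ S
  have hT : T.Finite :=
    (Set.finite_iUnion fun j => (Set.finite_range (f j)).image _).union hS
  obtain ⟨K, F, hF⟩ : ∃ (K : ℕ) (F : Fin K → CInf N), Set.range F = T := by
    have := hT.to_subtype
    obtain ⟨K, ⟨φ⟩⟩ := Finite.exists_equiv_fin T
    refine ⟨K, fun i => (φ.symm i).1, ?_⟩
    rw [Set.range_comp' Subtype.val, φ.symm.range_eq_univ, Set.image_univ, Subtype.range_coe]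
  refine ⟨K, F, prodSet e X, isClosed_prodSet e hX, ?_⟩
  have hspan : ∀ j, Ideal.span (pull (fun i => e ⟨j, i⟩) '' (I j : Set (CInf (n j)))) =
      Ideal.span (pull (fun i => e ⟨j, i⟩) '' Set.range (f j)) ⊔
        (flatIdeal (X j)).map (pull fun i => e ⟨j, i⟩) := fun j => by
    show (I j).map _ = _
    rw [hI j, Ideal.map_span, Set.image_union, Ideal.span_union]
    rfl
  rw [hF, Ideal.span_union, Ideal.span_union, Ideal.span_union, Ideal.span_eq,
    flatIdeal_prodSet e hX, Ideal.span_iUnion, Ideal.span_iUnion, iSup_congr hspan, iSup_sup_eq,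
    sup_right_comm]

end SmoothRings

theorem proposition2p27 :
    (SmoothRings.ClosedUnderPushouts.{u} SmoothRings.IsFG.{u} ∧
      SmoothRings.ClosedUnderPushouts.{u} SmoothRings.IsFP.{u} ∧
      SmoothRings.ClosedUnderPushouts.{u} SmoothRings.IsGood.{u}) ∧
    (SmoothRings.ClosedUnderFiniteColimits.{u, w} SmoothRings.IsFG.{u} ∧
      SmoothRings.ClosedUnderFiniteColimits.{u, w} SmoothRings.IsFP.{u} ∧
      SmoothRings.ClosedUnderFiniteColimits.{u, w} SmoothRings.IsGood.{u}) := by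
  rw [SmoothRings.isFG_eq, SmoothRings.isFP_eq, SmoothRings.isGood_eq]
  exact ⟨⟨SmoothRings.closedUnderPushouts_hasPresentation SmoothRings.stableUnderGluing_true,
      SmoothRings.closedUnderPushouts_hasPresentation SmoothRings.stableUnderGluing_fg,
      SmoothRings.closedUnderPushouts_hasPresentation SmoothRings.stableUnderGluing_good⟩,
    SmoothRings.closedUnderFiniteColimits_hasPresentation SmoothRings.stableUnderGluing_true,
    SmoothRings.closedUnderFiniteColimits_hasPresentation SmoothRings.stableUnderGluing_fg,
    SmoothRings.closedUnderFiniteColimits_hasPresentation SmoothRings.stableUnderGluing_good⟩
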